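/- Let $S$ be a monoid. A (left) $S$-polygon is a nonempty set $A$ with an action of $S$ satisfying $s_1(s_2a)=(s_1s_2)a$ and $1a=a$, regarded as a structure of the language $L_S$ with one unary function symbol for each $s\in S$. An element $a\in A$ is act-regular if there is a homomorphism of polygons $\varphi: Sa\to S$ with $\varphi(a)a=a$, and $A$ is regular if all its elements are act-regular. Let $\mathfrak R$ be the class of all regular $S$-polygons and let $R\subseteq S$ be the regular core of $S$, i.e. the union of all regular subpolygons of the left polygon ${}_SS$; assume $R\neq\emptyset$. A class $K$ of $L_S$-structures is axiomatizable if it is the class of all models of some set of $L_S$-sentences. It is model complete if its theory $T=\mathrm{Th}(K)$ (the set of all $L_S$-sentences true in every structure of $K$) is model complete, i.e. $T$ is consistent and $A\preceq B$ whenever $A\subseteq B$ are models of $T$. **Theorem 5.1.** Assume that $\mathfrak R$ is axiomatizable. Then $\mathfrak R$ is model complete if and only if the following three conditions hold. 1. $S$ is regularly linearly ordered: for every $a\in R$ the set $\{Sb\mid b\in S,\ Sb\subseteq Sa\}$ is linearly ordered by inclusion. 2. For every idempotent $e\in R$ and all $a,a_1,\dots,a_m\in S$ (where $m\ge 0$):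 if $Sa\subsetneq Se$ and $e\notin\bigcup_{i=1}^m a_iS$, then there are pairwise distinct idempotents $e_j\in R$ $(j\in\omega)$ such that $Sa=Se_j$ and $e_j\in eS\setminus\bigcup_{i=1}^m a_iS$ for every $j\in\omega$. 3. For all idempotents $e,f\in R$ the set $eSf$ is infinite. -/

import Mathlib

open FirstOrder

universe u

namespace SPolygon

section Acts

variable (S : Type u) [Monoid S]

/-- An element `a` of a left `S`-polygon `A` (that is, `MulAction S A`) is act-regular if there is
a homomorphism of polygons `φ : S a → S` with `φ(a) a = a`. Here `MulAction.orbit S a` is the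
cyclic subpolygon `S a = {s • a | s ∈ S}`. -/
def IsActRegular {A : Type u} [MulAction S A] (a : A) : Prop :=
  ∃ φ : MulAction.orbit S a →[S] S, φ ⟨a, MulAction.mem_orbit_self a⟩ • a = a

/-- A polygon is regular if all of its elements are act-regular. -/
def IsRegularPolygon (A : Type u) [MulAction S A] : Prop :=
  ∀ a : A, IsActRegular S a

/-- The regular core `R` of `S`: the union of all regular subpolygons of the left polygon `S`. -/
def regularCore : Set S :=
  {a | ∃ B : SubMulAction S S, IsRegularPolygon S B ∧ a ∈ B}

/-- The principal left ideal `S a`. -/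
def leftIdeal {S : Type u} [Monoid S] (a : S) : Set S := {x | ∃ s, x = s * a}

/-- The principal right ideal `a S`. -/
def rightIdeal {S : Type u} [Monoid S] (a : S) : Set S := {x | ∃ s, x = a * s}

/-- `S` is regularly linearly ordered: for `a ∈ R` the set of principal left ideals contained
in `S a` is linearly ordered by inclusion. -/
def IsRegularlyLinearlyOrdered : Prop :=
  ∀ a ∈ regularCore S,
    IsChain (· ⊆ ·) {I : Set S | ∃ b, I = leftIdeal b ∧ leftIdeal b ⊆ leftIdeal a}

end Acts

section Languages

/-- The function symbols of the language of `S`-polygons: one unary symbol for each `s ∈ S`. -/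
inductive ActFunc (S : Type u) : ℕ → Type u
  | smul (s : S) : ActFunc S 1

/-- The language `L_S` of `S`-polygons. -/
def actLanguage (S : Type u) : FirstOrder.Language.{u, 0} where
  Functions := ActFunc S
  Relations := fun _ => Empty

/-- A class of `L`-structures. Only its nonempty members are ever considered. -/
abbrev StructureClass (L : FirstOrder.Language.{u, 0}) : Type (u + 1) :=
  (A : Type u) → L.Structure A → Prop

variable {L : FirstOrder.Language.{u, 0}}

/-- A class of structures is axiomatizable if its (nonempty) members are exactly the models of
some set of sentences. -/
def IsAxiomatizable (K : StructureClass L) : Prop :=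
  ∃ Z : L.Theory, ∀ (A : Type u) (iA : L.Structure A) [Nonempty A], K A iA ↔ A ⊨ Z

/-- The elementary theory `Th(K)`: all sentences true in every (nonempty) structure of `K`. -/
def theoryOf (K : StructureClass L) : L.Theory :=
  {σ | ∀ (A : Type u) (iA : L.Structure A) [Nonempty A], K A iA → A ⊨ σ}

/-- A theory is model complete if it is consistent and, for all models `A ⊆ B` of it, `A` is an
elementary substructure of `B`. -/
def IsModelCompleteTheory (T : L.Theory) : Prop :=
  T.IsSatisfiable ∧
    ∀ (B : Type u) (_ : L.Structure B) [Nonempty B], B ⊨ T →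
      ∀ A : L.Substructure B, Nonempty A → A ⊨ T → A.IsElementary

/-- A class of structures is model complete if its elementary theory is. -/
def IsModelCompleteClass (K : StructureClass L) : Prop :=
  IsModelCompleteTheory (theoryOf K)

/-- The class of regular `S`-polygons, as a class of `L_S`-structures: the unary operations define
a left action of the monoid `S`, and the resulting polygon is regular. -/
def regularPolygons (S : Type u) [Monoid S] : StructureClass (actLanguage S) :=
  fun A iA =>
    ∃ _ : MulAction S A,
      (∀ (s : S) (a : A),
        iA.funMap (ActFunc.smul s : (actLanguage S).Functions 1) ![a] = s • a) ∧
      IsRegularPolygon S A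

end Languages

end SPolygon

open SPolygon

/-! An element `a` of a regular polygon generates a copy of `Se` for an idempotent `e` of the core
(`Represents`), so identities between multiples of `a` become equations in `S`. Axiomatizability
enters mainly through ultrapowers, which stay regular. Applied to the core, this yields a minimal
idempotent below every idempotent, and a finite cover of the core solutions of `s * x = t * x` by
right ideals `cS`. The cover translates finitely many inequations at `e` into the requirement `e ∉ ⋃
cᵢS` of condition 2.

Sufficiency: for regular `A ⊆ B` and `b ∈ B`, each finite part of the quantifier-free type of `b`
over `A` is realized in `A` (`exists_approximation`). The linear order reduces finitely many
multiples of `b` to one extremal multiple inside `A` and one outside. Infinitely many candidates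
then come from condition 2 if some listed multiple lies in `A`, and from condition 3 otherwise.
Hence `A ∪ Sb` embeds over `A` into an ultrapower of `A`, and induction on formulas with Łoś's
theorem shows that all embeddings are elementary.

Necessity: if a condition fails, some existential formula holds in a regular `B` but not in a
subpolygon `A`. The pairs are `Sf ⊆ Sf ⊔ Se` for condition 3, `Sa ⊆ Se` for condition 2, and a
subpolygon of two glued copies of the core for condition 1. -/

namespace SPolygon

/-! ### Act-regularity through idempotents -/

section Representatives

variable {S : Type u} [Monoid S]

/-- `e` represents `a` if `s e ↦ s a` is a well defined isomorphism `S e → S a` and `e a = a`. -/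
structure Represents {A : Type u} [MulAction S A] (e : S) (a : A) : Prop where
  smul_eq : e • a = a
  mul_eq : ∀ s t : S, s • a = t • a → s * e = t * e

namespace Represents

variable {A : Type u} [MulAction S A] {e : S} {a : A}

theorem idem (h : Represents e a) : e * e = e := by
  have := h.mul_eq e 1 (by rw [h.smul_eq, one_smul])
  rwa [one_mul] at this

theorem smul_eq_smul_iff (h : Represents e a) (s t : S) : s • a = t • a ↔ s * e = t * e := by
  refine ⟨h.mul_eq s t, fun hst => ?_⟩
  rw [← h.smul_eq, ← mul_smul, ← mul_smul, hst]

theorem smul_mul (h : Represents e a) (s : S) : (s * e) • a = s • a := by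
  rw [mul_smul, h.smul_eq]

theorem map {B : Type u} [MulAction S B] (h : Represents e a) (f : A →[S] B)
    (hf : Function.Injective f) : Represents e (f a) where
  smul_eq := by rw [← map_smul, h.smul_eq]
  mul_eq s t hst := h.mul_eq s t (hf (by rw [map_smul, map_smul, hst]))

theorem of_map {B : Type u} [MulAction S B] (f : A →[S] B)
    (hf : Function.Injective f) (h : Represents e (f a)) : Represents e a where
  smul_eq := hf (by rw [map_smul, h.smul_eq])
  mul_eq s t hst := h.mul_eq s t (by rw [← map_smul, ← map_smul, hst])

end Represents

theorem isActRegular_iff {A : Type u} [MulAction S A] {a : A} :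
    IsActRegular S a ↔ ∃ e : S, Represents e a := by
  constructor
  · rintro ⟨φ, hφ⟩
    refine ⟨_, hφ, fun s t hst => ?_⟩
    rw [← smul_eq_mul, ← smul_eq_mul, ← map_smul, ← map_smul]
    congr 1
    exact Subtype.ext hst
  · rintro ⟨e, he⟩
    choose σ hσ using fun y : MulAction.orbit S a => MulAction.mem_orbit_iff.1 y.2
    refine ⟨⟨fun y => σ y * e, fun s y => ?_⟩, ?_⟩
    · change σ (s • y) * e = s * (σ y * e)
      rw [← mul_assoc]
      apply he.mul_eq
      rw [hσ, mul_smul, hσ]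
      rfl
    · change (σ _ * e) • a = a
      rw [he.smul_mul, hσ]

theorem isRegularPolygon_iff {A : Type u} [MulAction S A] :
    IsRegularPolygon S A ↔ ∀ a : A, ∃ e : S, Represents e a :=
  forall_congr' fun _ => isActRegular_iff

theorem IsRegularPolygon.of_injective {A B : Type u} [MulAction S A] [MulAction S B]
    (hB : IsRegularPolygon S B) (f : A →[S] B) (hf : Function.Injective f) :
    IsRegularPolygon S A := by
  rw [isRegularPolygon_iff] at *
  intro a
  obtain ⟨e, he⟩ := hB (f a)
  exact ⟨e, .of_map f hf he⟩

theorem IsRegularPolygon.subMulAction {B : Type u} [MulAction S B]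
    (hB : IsRegularPolygon S B) (A : SubMulAction S B) : IsRegularPolygon S A :=
  hB.of_injective A.subtype A.subtype_injective

/-- The subpolygon `S a`. -/
def cyclic {A : Type u} [MulAction S A] (a : A) : SubMulAction S A where
  carrier := {x | ∃ s : S, x = s • a}
  smul_mem' := by
    rintro c _ ⟨s, rfl⟩
    exact ⟨c * s, (mul_smul _ _ _).symm⟩

/-- Since `Se` is isomorphic to `Sa`, a representative of `s • a` also represents `s * e`. -/
theorem Represents.mem_regularCore {A : Type u} [MulAction S A] (hA : IsRegularPolygon S A)
    {e : S} {a : A} (h : Represents e a) : e ∈ regularCore S := by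
  refine ⟨cyclic e, ?_, 1, (one_smul _ _).symm⟩
  rw [isRegularPolygon_iff] at *
  rintro ⟨_, s, rfl⟩
  obtain ⟨g, hg⟩ := hA (s • a)
  refine ⟨g, ?_, fun p q hpq => hg.mul_eq p q ?_⟩
  · have := hg.smul_eq
    rw [← mul_smul, h.smul_eq_smul_iff, mul_assoc] at this
    exact Subtype.ext this
  · have := congrArg Subtype.val hpq
    change p * (s * e) = q * (s * e) at this
    rwa [← mul_smul, ← mul_smul, h.smul_eq_smul_iff, mul_assoc, mul_assoc]

theorem mul_mem_regularCore {a : S} (s : S) (ha : a ∈ regularCore S) : s * a ∈ regularCore S := by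
  obtain ⟨B, hB, haB⟩ := ha
  exact ⟨B, hB, B.smul_mem s haB⟩

theorem exists_represents {a : S} (ha : a ∈ regularCore S) :
    ∃ e ∈ regularCore S, e * e = e ∧ Represents e a := by
  obtain ⟨B, hB, haB⟩ := ha
  obtain ⟨e, he⟩ := isRegularPolygon_iff.1 hB ⟨a, haB⟩
  exact ⟨e, he.mem_regularCore hB, he.idem, he.map B.subtype B.subtype_injective⟩

variable (S) in
/-- The regular core as a subpolygon of `S`. -/
def core : SubMulAction S S where
  carrier := regularCore S
  smul_mem' s _ hx := mul_mem_regularCore s hx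

theorem isRegularPolygon_core : IsRegularPolygon S (core S) := by
  rw [isRegularPolygon_iff]
  rintro ⟨a, ha⟩
  obtain ⟨e, -, -, he⟩ := exists_represents ha
  exact ⟨e, .of_map (core S).subtype (core S).subtype_injective he⟩

end Representatives

/-! ### Polygons as structures, and their ultrapowers -/

section Structures

variable {S : Type u} [Monoid S]

/-- The symbol of `L_S` for the action of `s`. -/
abbrev actSymbol (s : S) : (actLanguage S).Functions 1 := ActFunc.smul s

/-- A polygon as an `L_S`-structure. -/
@[reducible] def actStructure (S A : Type u) [Monoid S] [MulAction S A] :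
    (actLanguage S).Structure A where
  funMap := fun {_} F v => match F with
    | ActFunc.smul s => s • v 0
  RelMap := fun r _ => r.elim

/-- The structure `iA` is the one given by the action. -/
def Compatible (S : Type u) [Monoid S] (A : Type u) [MulAction S A]
    [iA : (actLanguage S).Structure A] : Prop :=
  ∀ (s : S) (a : A), iA.funMap (ActFunc.smul s : (actLanguage S).Functions 1) ![a] = s • a

theorem compatible_actStructure (A : Type u) [MulAction S A] :
    @Compatible S _ A _ (actStructure S A) := fun _ _ => rfl

/-- An injective homomorphism of polygons as an embedding of structures. -/
def embeddingOfHom {A B : Type u} [MulAction S A] [MulAction S B]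
    [(actLanguage S).Structure A] [(actLanguage S).Structure B]
    (hA : Compatible S A) (hB : Compatible S B) (f : A →[S] B) (hf : Function.Injective f) :
    A ↪[actLanguage S] B where
  toFun := f
  inj' := hf
  map_fun' := by
    rintro n ⟨s⟩ v
    obtain ⟨a, rfl⟩ : ∃ a, v = ![a] := ⟨v 0, by ext i; fin_cases i; rfl⟩
    have h : (f ∘ ![a]) = ![f a] := by ext i; fin_cases i; rfl
    rw [h]
    exact ((congrArg f (hA s a)).trans (map_smul f s a)).trans (hB s (f a)).symm
  map_rel' := fun r => r.elim

/-- An embedding of structures as a homomorphism of polygons. -/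
def homOfEmbedding {A B : Type u} [MulAction S A] [MulAction S B]
    [(actLanguage S).Structure A] [(actLanguage S).Structure B]
    (hA : Compatible S A) (hB : Compatible S B) (f : A ↪[actLanguage S] B) : A →[S] B where
  toFun := f
  map_smul' s a := by
    have h : (f ∘ ![a]) = ![f a] := by ext i; fin_cases i; rfl
    have := f.map_fun (actSymbol s) ![a]
    rw [h] at this
    exact ((congrArg f (hA s a)).symm.trans this).trans (hB s (f a))

theorem regularPolygons_of {A : Type u} [MulAction S A] [iA : (actLanguage S).Structure A]
    (hc : Compatible S A) (hA : IsRegularPolygon S A) : regularPolygons S A iA :=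
  ⟨_, hc, hA⟩

/-- The ultrapower of `A`. -/
abbrev Ultrapower {I : Type u} (U : Ultrafilter I) (A : Type u) : Type u :=
  (U : Filter I).Product fun _ : I => A

/-- The class of a family in the ultrapower. -/
def toUltrapower {I : Type u} (U : Ultrafilter I) {A : Type u} (x : I → A) : Ultrapower U A :=
  Quotient.mk _ x

theorem regularPolygons_ultrapower (hax : IsAxiomatizable (regularPolygons S)) {A I : Type u}
    [Nonempty A] [MulAction S A] [iA : (actLanguage S).Structure A] (hc : Compatible S A)
    (hA : IsRegularPolygon S A) (U : Ultrafilter I) :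
    regularPolygons S (Ultrapower U A) Language.Ultraproduct.structure := by
  obtain ⟨Z, hZ⟩ := hax
  have hAZ := (hZ A iA).1 (regularPolygons_of hc hA)
  refine (hZ _ _).2 ⟨fun φ hφ => ?_⟩
  rw [Language.Ultraproduct.sentence_realize]
  exact .of_forall fun _ => hAZ.realize_of_mem φ hφ

theorem Compatible.smul_toUltrapower {A I : Type u} [MulAction S A]
    [(actLanguage S).Structure A] (hA : Compatible S A) (U : Ultrafilter I)
    [MulAction S (Ultrapower U A)] (hU : Compatible S (Ultrapower U A)) (s : S) (x : I → A) :
    s • toUltrapower U x = toUltrapower U fun i => s • x i := by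
  rw [← hU s]
  have h : ![toUltrapower U x] = fun i => toUltrapower U (![x] i) := by
    ext i; fin_cases i; rfl
  rw [h]
  refine (Language.Ultraproduct.funMap_cast (M := fun _ : I => A) (actSymbol s) ![x]).trans ?_
  refine congrArg (toUltrapower U) ?_
  ext i
  rw [← hA s]
  congr 1
  ext j; fin_cases j; rfl

theorem toUltrapower_eq_iff {A I : Type u} (U : Ultrafilter I) (x y : I → A) :
    toUltrapower U x = toUltrapower U y ↔ ∀ᶠ i in (U : Filter I), x i = y i :=
  Quotient.eq''

/-- In an ultrapower of the regular core every element is represented by an idempotent. -/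
theorem exists_represents_ultrapower (hax : IsAxiomatizable (regularPolygons S)) {I : Type u}
    (U : Ultrafilter I) (x : I → S) (hx : ∀ i, x i ∈ regularCore S) :
    ∃ e ∈ regularCore S, e * e = e ∧ (∀ᶠ i in (U : Filter I), e * x i = x i) ∧
      ∀ s t : S, (∀ᶠ i in (U : Filter I), s * x i = t * x i) → s * e = t * e := by
  let _ := actStructure S (core S)
  have hc : Compatible S (core S) := compatible_actStructure (core S)
  obtain ⟨i₀⟩ : Nonempty I := by
    by_contra h
    rw [not_nonempty_iff] at h
    exact (Ultrafilter.nonempty_of_mem (f := U) Filter.univ_mem).elim fun i _ => h.elim i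
  have : Nonempty (core S) := ⟨⟨x i₀, hx i₀⟩⟩
  obtain ⟨act, hU, hreg⟩ := regularPolygons_ultrapower hax hc isRegularPolygon_core U
  have hU' : Compatible S (Ultrapower U (core S)) := hU
  let y : I → core S := fun i => ⟨x i, hx i⟩
  obtain ⟨e, he⟩ := isRegularPolygon_iff.1 hreg (toUltrapower U y)
  refine ⟨e, he.mem_regularCore hreg, he.idem, ?_, fun s t hst => he.mul_eq s t ?_⟩
  · have := he.smul_eq
    rw [hc.smul_toUltrapower U hU', toUltrapower_eq_iff] at this
    exact this.mono fun i hi => congrArg Subtype.val hi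
  · rw [hc.smul_toUltrapower U hU', hc.smul_toUltrapower U hU', toUltrapower_eq_iff]
    exact hst.mono fun i hi => Subtype.ext hi

end Structures

/-! ### Finiteness properties of the core and approximation inside a subpolygon -/

section CoreConditions

variable {S : Type u} [Monoid S]

/-- Idempotents of the regular core satisfy the descending chain condition. -/
theorem exists_minimal_idempotent (hax : IsAxiomatizable (regularPolygons S)) {e : S}
    (he : e ∈ regularCore S) (hee : e * e = e) :
    ∃ g ∈ regularCore S, g * g = g ∧ e * g = g ∧ g * e = g ∧
      ∀ h ∈ regularCore S, h * h = h → g * h = h → h * g = h → h = g := by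
  let D : Set S := {g | g ∈ regularCore S ∧ g * g = g ∧ e * g = g ∧ g * e = g}
  by_contra hcon
  have step : ∀ g : D, ∃ h : D, g.1 * h.1 = h.1 ∧ h.1 * g.1 = h.1 ∧ h.1 ≠ g.1 := by
    rintro ⟨g, hg, hgg, heg, hge⟩
    by_contra hno
    refine hcon ⟨g, hg, hgg, heg, hge, fun h hh hhh hgh hhg => ?_⟩
    by_contra hne
    refine hno ⟨⟨h, hh, hhh, ?_, ?_⟩, hgh, hhg, hne⟩
    · rw [← hgh, ← mul_assoc, heg]
    · rw [← hhg, mul_assoc, hge]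
  choose next hnext using step
  let x : ℕ → D := fun n => Nat.rec ⟨e, he, hee, hee, hee⟩ (fun _ g => next g) n
  have hx : ∀ n, (x n).1 * (x (n + 1)).1 = (x (n + 1)).1 ∧
      (x (n + 1)).1 * (x n).1 = (x (n + 1)).1 ∧ (x (n + 1)).1 ≠ (x n).1 := fun n => hnext (x n)
  clear_value x
  have hmul : ∀ i k, (x i).1 * (x (i + k)).1 = (x (i + k)).1 := by
    intro i k
    induction k with
    | zero => exact (x i).2.2.1
    | succ k ih => rw [← add_assoc, ← (hx (i + k)).1, ← mul_assoc, ih]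
  -- A nonprincipal ultrafilter makes every tail of the strictly descending chain large; `ULift`
  -- only adjusts the universe.
  let U : Ultrafilter (ULift.{u} ℕ) := (Filter.hyperfilter ℕ).map ULift.up
  have hU : ∀ p : ℕ → Prop, (∀ᶠ i in (U : Filter (ULift.{u} ℕ)), p i.down) ↔
      ∀ᶠ i in (Filter.hyperfilter ℕ : Filter ℕ), p i := fun p => Iff.rfl
  have hlarge : ∀ i, ∀ᶠ j in (Filter.hyperfilter ℕ : Filter ℕ), i ≤ j := fun i =>
    Filter.Eventually.filter_mono Nat.hyperfilter_le_atTop (Filter.eventually_ge_atTop i)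
  obtain ⟨f, -, -, hf, hsep⟩ :=
    exists_represents_ultrapower hax U (fun i => (x i.down).1) fun i => (x i.down).2.1
  obtain ⟨i, hi⟩ := ((hU fun i => f * (x i).1 = (x i).1).1 hf).exists
  -- Each `x k` fixes the tail of the chain, hence also its limit representative `f`. As `f` fixes
  -- some `x i`, the chain collapses at `i`.
  have hfix : ∀ k, (x k).1 * f = f := fun k => by
    have := hsep (x k).1 1 ((hU fun i => (x k).1 * (x i).1 = 1 * (x i).1).2
      ((hlarge k).mono fun j hj => ?_))
    · rwa [one_mul] at this
    · obtain ⟨l, rfl⟩ := Nat.exists_eq_add_of_le hj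
      rw [hmul, one_mul]
  refine (hx i).2.2 ?_
  calc (x (i + 1)).1 = (x (i + 1)).1 * (x i).1 := (hx i).2.1.symm
    _ = (x (i + 1)).1 * f * (x i).1 := by rw [mul_assoc, hi]
    _ = (x i).1 := by rw [hfix, hi]

/-- The solutions in the regular core of one equation are covered by finitely many principal right
ideals generated by solutions. -/
theorem exists_finset_cover (hax : IsAxiomatizable (regularPolygons S)) (s t : S) :
    ∃ C : Finset S, (∀ c ∈ C, s * c = t * c) ∧
      ∀ x ∈ regularCore S, s * x = t * x → ∃ c ∈ C, ∃ y, x = c * y := by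
  classical
  by_contra hcon
  let X : Set S := {x | x ∈ regularCore S ∧ s * x = t * x}
  have key : ∀ i : Finset X, ∃ x ∈ regularCore S, s * x = t * x ∧
      ∀ c ∈ i, ¬∃ y, x = c.1 * y := by
    intro i
    by_contra hno
    refine hcon ⟨i.image Subtype.val, ?_, fun x hx hst => ?_⟩
    · simp only [Finset.mem_image]
      rintro _ ⟨c, -, rfl⟩
      exact c.2.2
    · by_contra hx'
      refine hno ⟨x, hx, hst, fun c hc hy => hx' ⟨c, Finset.mem_image_of_mem _ hc, hy⟩⟩
  choose x hx hst hcov using key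
  obtain ⟨e, he, -, hfix, hsep⟩ :=
    exists_represents_ultrapower hax (Ultrafilter.of (Filter.atTop : Filter (Finset X))) x hx
  -- The representative `e` is itself a solution, so it belongs to large finite sets `i`; yet `x i =
  -- e * x i` for some of these, against the choice of `x i`.
  have heX : e ∈ X := ⟨he, hsep s t (.of_forall hst)⟩
  have hlarge : ∀ᶠ i in (Ultrafilter.of (Filter.atTop : Filter (Finset X)) : Filter (Finset X)),
      {(⟨e, heX⟩ : X)} ≤ i :=
    Filter.Eventually.filter_mono (Ultrafilter.of_le _) (Filter.eventually_ge_atTop _)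
  obtain ⟨i, hi, hle⟩ := (hfix.and hlarge).exists
  exact hcov i _ (Finset.singleton_subset_iff.1 hle) ⟨x i, hi.symm⟩

/-- Collect the covers of the solution sets of the forbidden equations. If `e` were in some `cS`, it
would inherit the equation solved by `c`. -/
theorem exists_finset_cover_of_ne (hax : IsAxiomatizable (regularPolygons S)) (e : S)
    (F : Finset (S × S)) (hF : ∀ p ∈ F, p.1 * e ≠ p.2 * e) :
    ∃ C : Finset S, (∀ c ∈ C, ¬∃ y, e = c * y) ∧
      ∀ x ∈ regularCore S, (∀ c ∈ C, ¬∃ y, x = c * y) → ∀ p ∈ F, p.1 * x ≠ p.2 * x := by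
  classical
  choose C hC hcov using fun p : S × S => exists_finset_cover hax p.1 p.2
  refine ⟨F.biUnion C, fun c hc => ?_, fun x hx hxC p hp heq => ?_⟩
  · obtain ⟨p, hp, hcp⟩ := Finset.mem_biUnion.1 hc
    rintro ⟨y, rfl⟩
    refine hF p hp ?_
    rw [← mul_assoc, hC p c hcp, mul_assoc]
  · obtain ⟨c, hc, hy⟩ := hcov p x hx heq
    exact hxC c (Finset.mem_biUnion.2 ⟨p, hp, hc⟩) hy

theorem leftIdeal_subset_iff {a b : S} : leftIdeal a ⊆ leftIdeal b ↔ ∃ u, a = u * b := by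
  constructor
  · exact fun h => h ⟨1, (one_mul a).symm⟩
  · rintro ⟨u, rfl⟩ _ ⟨s, rfl⟩
    exact ⟨s * u, (mul_assoc _ _ _).symm⟩

variable (S) in
/-- Every idempotent `e` of the core can be approximated, as far as finitely many inequalities go,
by infinitely many idempotents of `e S` generating a given smaller left ideal. -/
def HasApproximations : Prop :=
  ∀ e ∈ regularCore S, e * e = e → ∀ a : S, a * e = a → (¬∃ u, e = u * a) →
    ∀ F : Finset (S × S), (∀ p ∈ F, p.1 * e ≠ p.2 * e) →
      ∃ g : ℕ → S, Function.Injective g ∧ ∀ j, g j ∈ regularCore S ∧ g j * g j = g j ∧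
        (∃ u, g j = u * a) ∧ a * g j = a ∧ e * g j = g j ∧ ∀ p ∈ F, p.1 * g j ≠ p.2 * g j

theorem hasApproximations (hax : IsAxiomatizable (regularPolygons S))
    (h : ∀ e ∈ regularCore S, IsIdempotentElem e → ∀ (a : S) (m : ℕ) (c : Fin m → S),
      leftIdeal a ⊂ leftIdeal e → e ∉ ⋃ i, rightIdeal (c i) →
      ∃ f : ℕ → S, (∀ j k, j ≠ k → f j ≠ f k) ∧ ∀ j, f j ∈ regularCore S ∧
        IsIdempotentElem (f j) ∧ leftIdeal a = leftIdeal (f j) ∧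
        f j ∈ rightIdeal e \ ⋃ i, rightIdeal (c i)) :
    HasApproximations S := by
  intro e he hee a hae hea F hF
  obtain ⟨C, hC, hcov⟩ := exists_finset_cover_of_ne hax e F hF
  obtain ⟨g, hinj, hg⟩ := h e he hee a C.card (fun i => (C.equivFin.symm i).1)
    ⟨leftIdeal_subset_iff.2 ⟨a, hae.symm⟩, fun hle => hea (leftIdeal_subset_iff.1 hle)⟩ (by
      rw [Set.mem_iUnion]
      rintro ⟨i, hi⟩
      exact hC _ (C.equivFin.symm i).2 hi)
  refine ⟨g, fun j k hjk => by_contra fun hne => hinj j k hne hjk, fun j => ?_⟩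
  obtain ⟨hgR, hgg, hag, ⟨y, hy⟩, hgC⟩ := hg j
  refine ⟨hgR, hgg, leftIdeal_subset_iff.1 hag.ge, ?_, ?_, hcov _ hgR fun c hc hyc => hgC ?_⟩
  · obtain ⟨u, hu⟩ := leftIdeal_subset_iff.1 hag.le
    rw [hu, mul_assoc, hgg.eq]
  · rw [hy, ← mul_assoc, hee]
  · exact Set.mem_iUnion.2 ⟨C.equivFin ⟨c, hc⟩, by simpa [rightIdeal] using hyc⟩

/-- A single approximation also exists when `Sa = Se`: `e` itself serves. -/
theorem HasApproximations.exists_shrink (h : HasApproximations S) {e : S}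
    (he : e ∈ regularCore S) (hee : e * e = e) {a : S} (hae : a * e = a)
    (F : Finset (S × S)) (hF : ∀ p ∈ F, p.1 * e ≠ p.2 * e) :
    ∃ g ∈ regularCore S, g * g = g ∧ (∃ u, g = u * a) ∧ a * g = a ∧ e * g = g ∧
      ∀ p ∈ F, p.1 * g ≠ p.2 * g := by
  by_cases hea : ∃ u, e = u * a
  · exact ⟨e, he, hee, hea, hae, hee, hF⟩
  · obtain ⟨g, -, hg⟩ := h e he hee a hae hea F hF
    exact ⟨g 0, hg 0⟩

theorem _root_.Finset.exists_forall_rel_of_total {α : Type*} (r : α → α → Prop)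
    (htotal : ∀ x y, r x y ∨ r y x) (htrans : ∀ x y z, r x y → r y z → r x z)
    (s : Finset α) (hs : s.Nonempty) : ∃ x ∈ s, ∀ y ∈ s, r x y := by
  classical
  induction hs using Finset.Nonempty.cons_induction with
  | singleton a => exact ⟨a, by simp, by simpa using htotal a a⟩
  | cons a s ha hs ih =>
    obtain ⟨x, hx, hxs⟩ := ih
    rcases htotal a x with h | h
    · refine ⟨a, by simp, fun y hy => ?_⟩
      rcases Finset.mem_cons.1 hy with rfl | hy
      · simpa using htotal y y
      · exact htrans _ _ _ h (hxs y hy)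
    · refine ⟨x, by simp [hx], fun y hy => ?_⟩
      rcases Finset.mem_cons.1 hy with rfl | hy
      · exact h
      · exact hxs y hy

theorem IsRegularlyLinearlyOrdered.total (h : IsRegularlyLinearlyOrdered S) {e : S}
    (he : e ∈ regularCore S) (s t : S) :
    (∃ u, s * e = u * (t * e)) ∨ ∃ u, t * e = u * (s * e) := by
  have := (h e he).total (x := leftIdeal (s * e)) (y := leftIdeal (t * e))
    ⟨_, rfl, leftIdeal_subset_iff.2 ⟨s, rfl⟩⟩ ⟨_, rfl, leftIdeal_subset_iff.2 ⟨t, rfl⟩⟩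
  simpa only [leftIdeal_subset_iff] using this

/-- Any regular polygon contains infinitely many elements approximating a given idempotent. -/
theorem exists_approximation_of_infinite (hax : IsAxiomatizable (regularPolygons S))
    (h2 : HasApproximations S)
    (h3 : ∀ e ∈ regularCore S, ∀ f ∈ regularCore S,
      IsIdempotentElem e → IsIdempotentElem f → {x | ∃ s, x = e * s * f}.Infinite)
    {B : Type u} [MulAction S B] (hB : IsRegularPolygon S B) (b : B) {e : S}
    (he : e ∈ regularCore S) (hee : e * e = e) (F : Finset (S × S))
    (hF : ∀ p ∈ F, p.1 * e ≠ p.2 * e) (Φ : Finset B) :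
    ∃ s : S, e • s • b = s • b ∧ s • b ∉ Φ ∧ ∀ p ∈ F, p.1 • s • b ≠ p.2 • s • b := by
  obtain ⟨f, hf⟩ := isRegularPolygon_iff.1 hB b
  -- Passing to `k` with `Sk = Sg` and `g` minimal ensures that points fixed by `k` satisfy no more
  -- identities than `k` does.
  obtain ⟨g, hgR, hgg, heg, hge, hmin⟩ := exists_minimal_idempotent hax he hee
  obtain ⟨k, hkR, hkk, ⟨u, hku⟩, hgk, hek, hkF⟩ := h2.exists_shrink he hee hge F hF
  have hinf := h3 k hkR f (hf.mem_regularCore hB) hkk hf.idem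
  have hinj : Set.InjOn (fun x : S => x • b) {x | ∃ s, x = k * s * f} := by
    rintro _ ⟨s, rfl⟩ _ ⟨t, rfl⟩ hst
    have := (hf.smul_eq_smul_iff _ _).1 hst
    simpa only [mul_assoc, hf.idem] using this
  obtain ⟨_, ⟨_, ⟨s, rfl⟩, rfl⟩, hsΦ⟩ := (hinf.image hinj).exists_notMem_finset Φ
  have hk : k • (k * s * f) • b = (k * s * f) • b := by
    rw [← mul_smul, ← mul_assoc, ← mul_assoc, hkk]
  refine ⟨k * s * f, ?_, hsΦ, fun p hp heq => hkF p hp ?_⟩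
  · rw [← hk, ← mul_smul, hek]
  · obtain ⟨h, hh⟩ := isRegularPolygon_iff.1 hB ((k * s * f) • b)
    have hkh : k * h = h := by
      have := (hh.smul_eq_smul_iff k 1).1 (by rw [hk, one_smul])
      rwa [one_mul] at this
    -- `g * h * k` is an idempotent below `g`
    have hkg : k * g = k := by rw [hku, mul_assoc, hgg]
    have hghk : g * h * k = g := by
      have hhR := hh.mem_regularCore hB
      have h1 : g * h * k * (g * h * k) = g * h * k := by
        calc g * h * k * (g * h * k) = g * h * (k * g) * (h * k) := by simp only [mul_assoc]
          _ = g * h * (k * h) * k := by rw [hkg]; simp only [mul_assoc]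
          _ = g * (h * h) * k := by rw [hkh]; simp only [mul_assoc]
          _ = g * h * k := by rw [hh.idem]
      refine hmin _ (mul_mem_regularCore _ hkR) h1 ?_ ?_
      · rw [← mul_assoc, ← mul_assoc, hgg]
      · rw [mul_assoc, hkg]
    have hhk : h * k = k := by
      calc h * k = k * g * (h * k) := by rw [hkg, ← mul_assoc, hkh]
        _ = k * (g * h * k) := by simp only [mul_assoc]
        _ = k := by rw [hghk, hkg]
    have := congrArg (· * k) ((hh.smul_eq_smul_iff _ _).1 heq)
    simpa only [mul_assoc, hhk] using this

/-- Finitely many conditions on an element `b` outside of a subpolygon `A` are realized in `A`. -/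
theorem exists_approximation (hax : IsAxiomatizable (regularPolygons S))
    (h1 : IsRegularlyLinearlyOrdered S) (h2 : HasApproximations S)
    (h3 : ∀ e ∈ regularCore S, ∀ f ∈ regularCore S,
      IsIdempotentElem e → IsIdempotentElem f → {x | ∃ s, x = e * s * f}.Infinite)
    {B : Type u} [MulAction S B] (hB : IsRegularPolygon S B) (A : SubMulAction S B)
    (hA : ∃ a, a ∈ A) {b : B} (hb : b ∉ A) {e : S} (he : Represents e b)
    (F : Finset S) (Φ : Finset B) :
    ∃ b' ∈ A, e • b' = b' ∧ (∀ s ∈ F, s • b ∈ A → s • b' = s • b) ∧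
      (∀ s ∈ F, s • b ∉ A → s • b' ∉ Φ) ∧
      ∀ s ∈ F, ∀ t ∈ F, s • b' = t • b' → s • b = t • b := by
  classical
  have heR := he.mem_regularCore hB
  have hee := he.idem
  -- Adding `1` makes `N` nonempty, because `b ∉ A`.
  let N := (insert 1 F).filter fun s => s • b ∉ A
  let P := F.filter fun s => s • b ∈ A
  let FF := (F ×ˢ F).filter fun p => p.1 * e ≠ p.2 * e
  have hFF : ∀ p ∈ FF, p.1 * e ≠ p.2 * e := fun p hp => (Finset.mem_filter.1 hp).2
  obtain ⟨s₀, hs₀, hmin⟩ := Finset.exists_forall_rel_of_total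
    (fun s t => ∃ u, s * e = u * (t * e)) (h1.total heR)
    (by rintro x y z ⟨u, hu⟩ ⟨v, hv⟩; exact ⟨u * v, by rw [hu, hv, mul_assoc]⟩) N
    ⟨1, Finset.mem_filter.2 ⟨Finset.mem_insert_self _ _, by rwa [one_smul]⟩⟩
  have hs₀A : s₀ • b ∉ A := (Finset.mem_filter.1 hs₀).2
  -- `s₀ * e` generates the least left ideal among the multiples outside `A`. Replacing `e` by `k`
  -- with `Sk = S(s₀ * e)` allows `b'` to be recovered from every `s • b'` with `s ∈ N`.
  obtain ⟨k, hkR, hkk, ⟨u₀, hku⟩, hsk, hek, hkF⟩ :=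
    h2.exists_shrink heR hee (a := s₀ * e) (by rw [mul_assoc, hee]) FF hFF
  have hkA : k • b ∉ A := fun hmem => hs₀A (by
    have := A.smul_mem (s₀ * e) hmem
    rwa [← mul_smul, hsk, he.smul_mul] at this)
  have hP : ∀ s ∈ P, s * k = s * e := by
    intro s hs
    rcases h1.total heR s s₀ with ⟨u, hu⟩ | ⟨u, hu⟩
    · rw [← hek, ← mul_assoc, hu, mul_assoc, hsk]
    · refine absurd ?_ hs₀A
      rw [← he.smul_mul s₀, hu, mul_smul, he.smul_mul]
      exact A.smul_mem u (Finset.mem_filter.1 hs).2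
  choose! v hv using hmin
  -- Since `b' = (u₀ * v s) • s • b'` for `s ∈ N`, keeping all these `s • b'` out of `Φ` only
  -- requires `b'` to avoid one finite set.
  suffices h : ∃ b' ∈ A, k • b' = b' ∧
      b' ∉ (N ×ˢ Φ).image (fun q => (u₀ * v q.1) • q.2) ∧ (∀ s ∈ P, s • b' = s • b) ∧
      ∀ p ∈ FF, p.1 • b' ≠ p.2 • b' by
    obtain ⟨b', hb'A, hkb, hbΦ, hbP, hbF⟩ := h
    have heb : e • b' = b' := by rw [← hkb, ← mul_smul, hek]
    refine ⟨b', hb'A, heb, fun s hs hsA => hbP s (Finset.mem_filter.2 ⟨hs, hsA⟩),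
      fun s hs hsA hsΦ => hbΦ ?_, fun s hs t ht hst => ?_⟩
    · have hsN : s ∈ N := Finset.mem_filter.2 ⟨Finset.mem_insert_of_mem hs, hsA⟩
      refine Finset.mem_image.2 ⟨(s, s • b'), Finset.mk_mem_product hsN hsΦ, ?_⟩
      calc (u₀ * v s) • s • b' = (u₀ * (v s * (s * e))) • b' := by
            conv_lhs => rw [← heb]
            simp only [← mul_smul, mul_assoc]
        _ = b' := by rw [← hv s hsN, ← hku, hkb]
    · by_contra hne
      exact hbF (s, t) (Finset.mem_filter.2 ⟨Finset.mk_mem_product hs ht,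
        fun heq => hne ((he.smul_eq_smul_iff s t).2 heq)⟩) hst
  rcases P.eq_empty_or_nonempty with hPe | hPn
  · obtain ⟨a, ha⟩ := hA
    obtain ⟨s, hs1, hs2, hs3⟩ := exists_approximation_of_infinite hax h2 h3 hB a hkR hkk FF hkF
      ((N ×ˢ Φ).image fun q => (u₀ * v q.1) • q.2)
    exact ⟨s • a, A.smul_mem s ha, hs1, hs2, by simp [hPe], hs3⟩
  · obtain ⟨s₁, hs₁, hmax⟩ := Finset.exists_forall_rel_of_total
      (fun s t => ∃ u, t * e = u * (s * e)) (fun s t => h1.total heR t s)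
      (by rintro x y z ⟨u, hu⟩ ⟨v, hv⟩; exact ⟨v * u, by rw [hv, hu, mul_assoc]⟩) P hPn
    have hs₁A : s₁ • b ∈ A := (Finset.mem_filter.1 hs₁).2
    have hgen : ∀ x, (∃ u, x = u * (s₁ * e)) → x * e = x ∧ x • b ∈ A := by
      rintro _ ⟨u, rfl⟩
      refine ⟨by simp only [mul_assoc, hee], ?_⟩
      rw [mul_smul, he.smul_mul]
      exact A.smul_mem u hs₁A
    -- `s₁ * e` generates the largest ideal among the multiples inside `A`. So `g j • b` lies in
    -- `A`, and `s₁ * e * g j = s₁ * e` forces agreement with `b` at every `s ∈ P`.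
    obtain ⟨g, hinj, hg⟩ := h2 k hkR hkk (s₁ * e)
      (by rw [mul_assoc, hek, hP s₁ hs₁]) (fun hk => hkA (hgen k hk).2) FF hkF
    have hge : ∀ j, g j * e = g j := fun j => (hgen _ (hg j).2.2.1).1
    have hinj' : Function.Injective fun j => g j • b := fun i j hij => hinj (by
      have := (he.smul_eq_smul_iff _ _).1 hij
      rwa [hge, hge] at this)
    obtain ⟨_, ⟨j, rfl⟩, hj⟩ := (Set.infinite_range_of_injective hinj').exists_notMem_finset
      ((N ×ˢ Φ).image fun q => (u₀ * v q.1) • q.2)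
    obtain ⟨-, -, hgA, hsg, hkg, hgF⟩ := hg j
    refine ⟨g j • b, (hgen _ hgA).2, by rw [← mul_smul, hkg], hj, fun s hs => ?_,
      fun p hp heq => hgF p hp ?_⟩
    · obtain ⟨u, hu⟩ := hmax s hs
      rw [← mul_smul, ← he.smul_mul s, ← hkg, ← mul_assoc, hP s hs, hu, mul_assoc, hsg]
    · rw [← mul_smul, ← mul_smul, he.smul_eq_smul_iff] at heq
      simpa only [mul_assoc, hge] using heq

end CoreConditions

/-! ### Sufficiency: embeddings of regular polygons are elementary -/

section ModelCompleteness

variable {S : Type u} [Monoid S]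

/-- A one-generated extension of `A` inside a regular polygon `B` embeds over `A` into an
ultrapower of `A`. -/
theorem exists_hom_ultrapower (hax : IsAxiomatizable (regularPolygons S))
    (h1 : IsRegularlyLinearlyOrdered S) (h2 : HasApproximations S)
    (h3 : ∀ e ∈ regularCore S, ∀ f ∈ regularCore S,
      IsIdempotentElem e → IsIdempotentElem f → {x | ∃ s, x = e * s * f}.Infinite)
    {A B : Type u} [MulAction S A] [MulAction S B] [Nonempty A]
    [(actLanguage S).Structure A] (hA : Compatible S A)
    (hB : IsRegularPolygon S B) (f : A →[S] B) (hf : Function.Injective f) (b : B) :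
    ∃ (I : Type u) (U : Ultrafilter I), ∀ [MulAction S (Ultrapower U A)],
      Compatible S (Ultrapower U A) →
      ∃ (C : SubMulAction S B) (g : C →[S] Ultrapower U A), Function.Injective g ∧ b ∈ C ∧
        ∀ a, ∃ h : f a ∈ C, g ⟨f a, h⟩ = toUltrapower U fun _ => a := by
  classical
  let D : SubMulAction S B :=
    ⟨Set.range f, by rintro c _ ⟨a, rfl⟩; exact ⟨c • a, map_smul f c a⟩⟩
  -- Identities of `b` pass to `a` for all `s`, `t` at once through `e`; the other clauses are
  -- needed only on the finite data and become exact in the ultraproduct.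
  have happrox : ∀ i : Finset S × Finset A, ∃ a : A,
      (∀ s t : S, s • b = t • b → s • a = t • a) ∧
      (∀ s ∈ i.1, ∀ a', f a' = s • b → s • a = a') ∧
      (∀ s ∈ i.1, ∀ a' ∈ i.2, s • a = a' → f a' = s • b) ∧
      ∀ s ∈ i.1, ∀ t ∈ i.1, s • a = t • a → s • b = t • b := by
    rintro ⟨F, Φ⟩
    by_cases hb : b ∈ D
    · obtain ⟨a, rfl⟩ := hb
      refine ⟨a, fun s t h => hf ?_, fun s _ a' h => hf ?_, fun s _ a' _ h => ?_,
        fun s _ t _ h => ?_⟩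
      · rw [map_smul, map_smul, h]
      · rw [map_smul, h]
      · rw [← h, map_smul]
      · rw [← map_smul, h, map_smul]
    · obtain ⟨e, he⟩ := isRegularPolygon_iff.1 hB b
      obtain ⟨a₀⟩ := ‹Nonempty A›
      obtain ⟨_, ⟨a, rfl⟩, hea, hpos, hneg, hsep⟩ := exists_approximation hax h1 h2 h3 hB D
        ⟨f a₀, a₀, rfl⟩ hb he F (Φ.image f)
      refine ⟨a, fun s t h => hf ?_, fun s hs a' h => hf ?_, fun s hs a' ha' h => ?_,
        fun s hs t ht h => hsep s hs t ht ?_⟩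
      · rw [map_smul, map_smul, ← hea, ← mul_smul, ← mul_smul, he.mul_eq s t h]
      · rw [map_smul, hpos s hs ⟨a', h⟩, h]
      · by_cases hsb : s • b ∈ D
        · rw [← hpos s hs hsb, ← h, map_smul]
        · refine absurd (Finset.mem_image_of_mem f ha') ?_
          rw [← h, map_smul]
          exact hneg s hs hsb
      · rw [← map_smul, h, map_smul]
  choose x hx1 hx2 hx3 hx4 using happrox
  let U := Ultrafilter.of (Filter.atTop : Filter (Finset S × Finset A))
  have hlarge : ∀ j, ∀ᶠ i in (U : Filter (Finset S × Finset A)), j ≤ i := fun j =>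
    Filter.Eventually.filter_mono (Ultrafilter.of_le _) (Filter.eventually_ge_atTop j)
  have hS : ∀ s : S, ∀ᶠ i in (U : Filter (Finset S × Finset A)), s ∈ i.1 := fun s =>
    (hlarge ({s}, ∅)).mono fun i hi => Finset.singleton_subset_iff.1 hi.1
  have hAm : ∀ a : A, ∀ᶠ i in (U : Filter (Finset S × Finset A)), a ∈ i.2 := fun a =>
    (hlarge (∅, {a})).mono fun i hi => Finset.singleton_subset_iff.1 hi.2
  refine ⟨_, U, fun {_} hU => ?_⟩
  have hsm := hA.smul_toUltrapower U hU
  -- the graph of the embedding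
  let G : B → Ultrapower U A → Prop := fun c y =>
    (∃ a, f a = c ∧ y = toUltrapower U fun _ => a) ∨ ∃ s : S, c = s • b ∧ y = s • toUltrapower U x
  have hG1 : ∀ (a : A) (s : S), f a = s • b →
      (toUltrapower U fun _ => a) = s • toUltrapower U x := by
    intro a s h
    rw [hsm, toUltrapower_eq_iff]
    exact (hS s).mono fun i hi => (hx2 i s hi a h).symm
  have hG2 : ∀ (a : A) (s : S), (toUltrapower U fun _ => a) = s • toUltrapower U x →
      f a = s • b := by
    intro a s h
    rw [hsm, toUltrapower_eq_iff] at h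
    obtain ⟨i, ⟨hi1, hi2⟩, hi3⟩ := ((h.and (hS s)).and (hAm a)).exists
    exact hx3 i s hi2 a hi3 hi1.symm
  have hGfun : ∀ c y y', G c y → G c y' → y = y' := by
    rintro c y y' (⟨a, ha, rfl⟩ | ⟨s, hs, rfl⟩) (⟨a', ha', rfl⟩ | ⟨t, ht, rfl⟩)
    · rw [hf (ha.trans ha'.symm)]
    · exact hG1 a t (ha.trans ht)
    · exact (hG1 a' s (ha'.trans hs)).symm
    · rw [hsm, hsm, toUltrapower_eq_iff]
      exact .of_forall fun i => hx1 i s t (hs.symm.trans ht)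
  have hGinj : ∀ c c' y, G c y → G c' y → c = c' := by
    rintro c c' y (⟨a, rfl, rfl⟩ | ⟨s, rfl, rfl⟩) (⟨a', rfl, h⟩ | ⟨t, rfl, h⟩)
    · rw [toUltrapower_eq_iff] at h
      obtain ⟨i, hi⟩ := h.exists
      rw [hi]
    · exact hG2 a t h
    · exact (hG2 a' s h.symm).symm
    · rw [hsm, hsm, toUltrapower_eq_iff] at h
      obtain ⟨i, ⟨hi1, hi2⟩, hi3⟩ := ((h.and (hS s)).and (hS t)).exists
      exact hx4 i s hi2 t hi3 hi1
  have hGsmul : ∀ (s : S) c y, G c y → G (s • c) (s • y) := by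
    rintro s c y (⟨a, rfl, rfl⟩ | ⟨t, rfl, rfl⟩)
    · exact .inl ⟨s • a, map_smul f s a, hsm s _⟩
    · exact .inr ⟨s * t, (mul_smul _ _ _).symm, (mul_smul _ _ _).symm⟩
  let C : SubMulAction S B := ⟨{c | ∃ y, G c y}, fun s c ⟨y, hy⟩ => ⟨s • y, hGsmul s c y hy⟩⟩
  choose g hg using fun c : C => c.2
  refine ⟨C, ⟨g, fun s c => hGfun _ _ _ (hg (s • c)) (hGsmul s _ _ (hg c))⟩,
    fun c c' h => Subtype.ext (hGinj _ _ _ (hg c) ?_),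
    ⟨toUltrapower U x, .inr ⟨1, (one_smul _ _).symm, (one_smul _ _).symm⟩⟩,
    fun a => ⟨⟨_, .inl ⟨a, rfl, rfl⟩⟩, hGfun _ _ _ (hg _) (.inl ⟨a, rfl, rfl⟩)⟩⟩
  · change g c = g c' at h
    rw [h]
    exact hg c'

/-- In the quantifier step, a polygon `C` containing `b` and the image of `A` embeds both into `B`
and, over `A`, into an ultrapower of `A`. The induction hypothesis carries the formula from the
ultrapower, where Łoś's theorem gives it, through `C` to `B`. This requires an induction over all
embeddings simultaneously. -/
theorem realize_embedding_iff (hax : IsAxiomatizable (regularPolygons S))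
    (h1 : IsRegularlyLinearlyOrdered S) (h2 : HasApproximations S)
    (h3 : ∀ e ∈ regularCore S, ∀ f ∈ regularCore S,
      IsIdempotentElem e → IsIdempotentElem f → {x | ∃ s, x = e * s * f}.Infinite)
    {α : Type*} {n : ℕ} (φ : (actLanguage S).BoundedFormula α n) :
    ∀ {A B : Type u} [iA : (actLanguage S).Structure A] [iB : (actLanguage S).Structure B]
      [Nonempty A], regularPolygons S A iA → regularPolygons S B iB →
      ∀ (f : A ↪[actLanguage S] B) (v : α → A) (w : Fin n → A),
        φ.Realize (f ∘ v) (f ∘ w) ↔ φ.Realize v w := by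
  induction φ with
  | falsum => intros; rfl
  | equal t₁ t₂ =>
    intro A B iA iB _ _ _ f v w
    simp only [Language.BoundedFormula.Realize, ← Sum.comp_elim, Language.HomClass.realize_term,
      f.injective.eq_iff]
  | rel R => exact R.elim
  | imp φ ψ ihφ ihψ =>
    intro A B iA iB _ hA hB f v w
    simp only [Language.BoundedFormula.realize_imp, ihφ hA hB f, ihψ hA hB f]
  | @all n φ ih =>
    intro A B iA iB _ hA hB f v w
    simp only [Language.BoundedFormula.realize_all]
    refine ⟨fun h a => ?_, fun h b => ?_⟩
    · have := h (f a)
      rw [← Fin.comp_snoc] at this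
      exact (ih hA hB f _ _).1 this
    · have hA' := hA
      obtain ⟨actA, cA, rA⟩ := hA
      obtain ⟨actB, cB, rB⟩ := id hB
      have cA' : Compatible S A := cA
      have cB' : Compatible S B := cB
      obtain ⟨I, U, hU⟩ := exists_hom_ultrapower hax h1 h2 h3 cA' rB (homOfEmbedding cA' cB' f)
        f.injective b
      have hreg := regularPolygons_ultrapower hax cA' rA U
      obtain ⟨actU, cU, rU⟩ := id hreg
      obtain ⟨C, g, hg, hbC, hfC⟩ := hU cU
      let _ := actStructure S C
      have cC : Compatible S C := compatible_actStructure C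
      have hC : regularPolygons S C (actStructure S C) :=
        regularPolygons_of cC (rB.subMulAction C)
      have : Nonempty C := ⟨⟨b, hbC⟩⟩
      let ι : C ↪[actLanguage S] B := embeddingOfHom cC cB' C.subtype C.subtype_injective
      let γ : C ↪[actLanguage S] Ultrapower U A := embeddingOfHom cC cU g hg
      choose hfC' hgC using hfC
      let f' : A → C := fun a => ⟨f a, hfC' a⟩
      have hv : f ∘ v = ι ∘ (f' ∘ v) := rfl
      have hw : Fin.snoc (f ∘ w) b = ι ∘ Fin.snoc (α := fun _ => C) (f' ∘ w) ⟨b, hbC⟩ := by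
        rw [Fin.comp_snoc]; rfl
      have hv' : γ ∘ (f' ∘ v) = fun i => toUltrapower U fun _ => v i :=
        funext fun i => hgC (v i)
      have hw' : γ ∘ (f' ∘ w) = fun i => toUltrapower U fun _ => w i :=
        funext fun i => hgC (w i)
      rw [hv, hw, ih hC hB ι, ← ih hC hreg γ, Fin.comp_snoc, hv', hw']
      exact Language.BoundedFormula.realize_all.1
        ((Language.Ultraproduct.boundedFormula_realize_cast (M := fun _ : I => A) (u := U)
          φ.all (fun i _ => v i) (fun i _ => w i)).2 (.of_forall fun _ => h)) (γ ⟨b, hbC⟩)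

theorem model_theoryOf {L : FirstOrder.Language.{u, 0}} {K : StructureClass L} {A : Type u}
    {iA : L.Structure A} [Nonempty A] (h : K A iA) : A ⊨ theoryOf K :=
  ⟨fun _ hφ => hφ A iA h⟩

theorem IsAxiomatizable.of_model {L : FirstOrder.Language.{u, 0}} {K : StructureClass L}
    (hax : IsAxiomatizable K) {A : Type u}
    {iA : L.Structure A} [Nonempty A] (h : A ⊨ theoryOf K) : K A iA := by
  obtain ⟨Z, hZ⟩ := hax
  exact (hZ A iA).2 ⟨fun φ hφ => h.realize_of_mem φ fun B iB _ hB =>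
    ((hZ B iB).1 hB).realize_of_mem φ hφ⟩

theorem isModelCompleteClass_of (hR : (regularCore S).Nonempty)
    (hax : IsAxiomatizable (regularPolygons S))
    (h1 : IsRegularlyLinearlyOrdered S) (h2 : HasApproximations S)
    (h3 : ∀ e ∈ regularCore S, ∀ f ∈ regularCore S,
      IsIdempotentElem e → IsIdempotentElem f → {x | ∃ s, x = e * s * f}.Infinite) :
    IsModelCompleteClass (regularPolygons S) := by
  constructor
  · obtain ⟨a, ha⟩ := hR
    let _ := actStructure S (core S)
    have : Nonempty (core S) := ⟨⟨a, ha⟩⟩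
    have := model_theoryOf (regularPolygons_of (compatible_actStructure (core S))
      isRegularPolygon_core)
    exact Language.Theory.Model.isSatisfiable (core S)
  · intro B iB _ hB A _ hA n φ x
    have := realize_embedding_iff hax h1 h2 h3 φ (hax.of_model hA) (hax.of_model hB) A.subtype x
      default
    rw [Language.Formula.Realize, Language.Formula.Realize, ← this]
    congr!

end ModelCompleteness

/-! ### Necessity: existential formulas descending to subpolygons -/

section Necessity

variable {S : Type u} [Monoid S]

open Language in
/-- In a model complete class, a formula of the shape `∃ x, e x = x ∧ ⋀ s i x = p i ∧
⋀ ¬ ∃ z, d k z = x ∧ ⋀ x ≠ c` descends to regular subpolygons containing its parameters. -/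
theorem exists_mem_of_isModelCompleteClass (h : IsModelCompleteClass (regularPolygons S))
    {B : Type u} [MulAction S B] (hB : IsRegularPolygon S B) (A : SubMulAction S B)
    (hA : ∃ a, a ∈ A) (e : S) {ι κ : Type} [Finite ι] [Finite κ] (s : ι → S) (p : ι → B)
    (hp : ∀ i, p i ∈ A) (d : κ → S) (X : Set B) (hX : X.Finite) (hXA : X ⊆ A)
    (hx : ∃ x, e • x = x ∧ (∀ i, s i • x = p i) ∧ (∀ k z, d k • z ≠ x) ∧ x ∉ X) :
    ∃ x ∈ A, e • x = x ∧ (∀ i, s i • x = p i) ∧ (∀ k, ∀ z ∈ A, d k • z ≠ x) ∧ x ∉ X := by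
  let _ := actStructure S B
  have : Finite X := hX
  have : Nonempty B := hA.nonempty
  let A' : (actLanguage S).Substructure B :=
    ⟨A, by
      rintro n ⟨s⟩ v hv
      exact A.smul_mem s (hv 0)⟩
  have : Nonempty A' := hA.elim fun a ha => ⟨⟨a, ha⟩⟩
  have : Nonempty A := this
  have hreg : regularPolygons S A (Substructure.inducedStructure (S := A')) :=
    ⟨inferInstance, fun s a => rfl, hB.subMulAction A⟩
  have hel : A'.IsElementary := h.2 B _
    (model_theoryOf (regularPolygons_of (compatible_actStructure B) hB)) A' this
    (model_theoryOf hreg)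
  let φ : (actLanguage S).BoundedFormula A' 1 :=
    ((Functions.apply₁ (actSymbol e) (&0)) =' &0) ⊓
    ((BoundedFormula.iInf fun i : ι =>
      (Functions.apply₁ (actSymbol (s i)) (&0)) =' (Term.var (Sum.inl ⟨p i, hp i⟩))) ⊓
    ((BoundedFormula.iInf fun k : κ =>
      ∼(∃' ((Functions.apply₁ (actSymbol (d k)) (&1)) =' &0))) ⊓
    (BoundedFormula.iInf fun c : X =>
      ∼((&0) =' (Term.var (Sum.inl ⟨c.1, hXA c.2⟩))))))
  have hφ : Formula.Realize (M := B) φ.ex (fun a : A' => (a : B)) ↔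
      Formula.Realize (M := A') φ.ex id :=
    (ElementarySubstructure.subtype ⟨A', hel⟩).map_formula φ.ex id
  have hBr : Formula.Realize (M := B) φ.ex (fun a : A' => (a : B)) := by
    obtain ⟨x, h1, h2, h3, h4⟩ := hx
    rw [Formula.Realize, BoundedFormula.realize_ex]
    refine ⟨x, ?_⟩
    simp only [φ, BoundedFormula.realize_inf, BoundedFormula.realize_iInf,
      BoundedFormula.realize_not, BoundedFormula.realize_ex, BoundedFormula.realize_bdEqual]
    refine ⟨h1, h2, ?_, ?_⟩
    · rintro k ⟨z, hz⟩
      exact h3 k z hz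
    · rintro c hc
      have hc' : x = c := hc
      exact h4 (hc' ▸ c.2)
  rw [hφ, Formula.Realize, BoundedFormula.realize_ex] at hBr
  obtain ⟨⟨x, hxA⟩, hr⟩ := hBr
  simp only [φ, BoundedFormula.realize_inf, BoundedFormula.realize_iInf,
    BoundedFormula.realize_not, BoundedFormula.realize_ex, BoundedFormula.realize_bdEqual] at hr
  obtain ⟨h1, h2, h3, h4⟩ := hr
  refine ⟨x, hxA, congrArg Subtype.val h1, fun i => congrArg Subtype.val (h2 i),
    fun k z hz heq => h3 k ⟨⟨z, hz⟩, Subtype.ext heq⟩, fun hc => h4 ⟨x, hc⟩ rfl⟩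

theorem isRegularPolygon_sum {A B : Type u} [MulAction S A] [MulAction S B]
    (hA : IsRegularPolygon S A) (hB : IsRegularPolygon S B) : IsRegularPolygon S (A ⊕ B) := by
  rw [isRegularPolygon_iff] at *
  rintro (a | b)
  · obtain ⟨e, he⟩ := hA a
    exact ⟨e, he.map (B := A ⊕ B) ⟨Sum.inl, fun _ _ => rfl⟩ Sum.inl_injective⟩
  · obtain ⟨e, he⟩ := hB b
    exact ⟨e, he.map (B := A ⊕ B) ⟨Sum.inr, fun _ _ => rfl⟩ Sum.inr_injective⟩

theorem isRegularPolygon_cyclic {e : S} (he : e ∈ regularCore S) :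
    IsRegularPolygon S (cyclic (S := S) e) :=
  isRegularPolygon_core.of_injective
    (⟨fun x => ⟨x.1, by obtain ⟨_, s, rfl⟩ := x; exact mul_mem_regularCore s he⟩,
      fun _ _ => rfl⟩ : cyclic (S := S) e →[S] core S)
    fun _ _ hxy => Subtype.ext (congrArg (fun z : core S => z.1) hxy)

/-- In `Sf ⊔ Se` the generator of `Se` solves `e x = x` outside the copy of `eSf`. If `eSf` is
finite, such a solution descends to `Sf`, where every solution lies in `eSf`. -/
theorem infinite_of_isModelCompleteClass (h : IsModelCompleteClass (regularPolygons S)) {e f : S}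
    (he : e ∈ regularCore S) (hf : f ∈ regularCore S) (hee : IsIdempotentElem e) :
    {x | ∃ s, x = e * s * f}.Infinite := by
  intro hfin
  let A : SubMulAction S (cyclic (S := S) f ⊕ cyclic (S := S) e) :=
    ⟨Set.range Sum.inl, by rintro s _ ⟨a, rfl⟩; exact ⟨s • a, rfl⟩⟩
  let X : Set (cyclic (S := S) f ⊕ cyclic (S := S) e) :=
    Sum.inl '' (Subtype.val ⁻¹' {x | ∃ s, x = e * s * f})
  obtain ⟨_, ⟨x, rfl⟩, hx, -, -, hxX⟩ := exists_mem_of_isModelCompleteClass h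
    (isRegularPolygon_sum (isRegularPolygon_cyclic hf) (isRegularPolygon_cyclic he)) A
    ⟨_, ⟨f, 1, (one_smul _ _).symm⟩, rfl⟩ e (ι := Empty) (κ := Empty) nofun nofun nofun nofun X
    ((hfin.preimage Subtype.val_injective.injOn).image _) (Set.image_subset_range _ _)
    ⟨Sum.inr ⟨e, 1, (one_smul _ _).symm⟩, congrArg Sum.inr (Subtype.ext hee), nofun, nofun,
      by rintro ⟨_, _, h⟩; cases h⟩
  obtain ⟨s, hs⟩ := x.2
  have hx' : e * x.1 = x.1 := congrArg Subtype.val (Sum.inl_injective hx)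
  refine hxX ⟨x, ⟨s, ?_⟩, rfl⟩
  rw [mul_assoc]
  exact hx'.symm.trans (congrArg (e * ·) hs)

/-- The conditions defining `X` hold for `e` in `Se`, except membership in `Sa`. Were `X` finite,
`Sa` would contain a further solution outside `X`, which is absurd. -/
theorem approximations_of_isModelCompleteClass (h : IsModelCompleteClass (regularPolygons S))
    {e : S} (he : e ∈ regularCore S) (hee : IsIdempotentElem e) (a : S) (m : ℕ) (c : Fin m → S)
    (hae : leftIdeal a ⊂ leftIdeal e) (hc : e ∉ ⋃ i, rightIdeal (c i)) :
    ∃ f : ℕ → S, (∀ j k, j ≠ k → f j ≠ f k) ∧ ∀ j, f j ∈ regularCore S ∧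
      IsIdempotentElem (f j) ∧ leftIdeal a = leftIdeal (f j) ∧
      f j ∈ rightIdeal e \ ⋃ i, rightIdeal (c i) := by
  obtain ⟨u, hu⟩ := leftIdeal_subset_iff.1 hae.subset
  have hea : ∀ s, e ≠ s * a := fun s hs => hae.not_subset (leftIdeal_subset_iff.2 ⟨s, hs⟩)
  have ha : a * e = a := by rw [hu, mul_assoc, hee.eq]
  let X : Set S := {x | (∃ s, x = s * a) ∧ e * x = x ∧ a * x = a ∧
    ∀ i, ∀ z, (∃ s, z = s * a) → c i * z ≠ x}
  have hinf : X.Infinite := by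
    intro hfin
    let A : SubMulAction S (cyclic (S := S) e) :=
      ⟨{x | ∃ s, x.1 = s * a}, by
        rintro t ⟨_, _⟩ ⟨s, hs⟩
        exact ⟨t * s, (congrArg (t * ·) hs).trans (mul_assoc _ _ _).symm⟩⟩
    have hmem : ∀ s, s * a ∈ cyclic (S := S) e := fun s =>
      ⟨s * u, by rw [hu, smul_eq_mul, mul_assoc]⟩
    obtain ⟨x, hxA, h1, h2, h3, h4⟩ := exists_mem_of_isModelCompleteClass h
      (isRegularPolygon_cyclic he) A ⟨⟨1 * a, hmem 1⟩, 1, rfl⟩ e (ι := Unit) (κ := Fin m)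
      (fun _ => a) (fun _ => ⟨1 * a, hmem 1⟩) (fun _ => ⟨1, rfl⟩) c (Subtype.val ⁻¹' X)
      (hfin.preimage Subtype.val_injective.injOn) (fun x hx => hx.1)
      ⟨⟨e, 1, (one_smul _ _).symm⟩, Subtype.ext hee,
        fun _ => Subtype.ext (ha.trans (one_mul a).symm),
        fun k z hz => hc (Set.mem_iUnion.2 ⟨k, z.1, (congrArg Subtype.val hz).symm⟩),
        fun hX => hX.1.elim hea⟩
    exact h4 ⟨hxA, congrArg Subtype.val h1, (congrArg Subtype.val (h2 ())).trans (one_mul a),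
      fun i z ⟨s, hs⟩ hz => h3 i ⟨z, hs ▸ hmem s⟩ ⟨s, hs⟩ (Subtype.ext hz)⟩
  refine ⟨fun j => (hinf.natEmbedding X j).1, fun j k hjk heq => hjk
    ((hinf.natEmbedding X).injective (Subtype.ext heq)), fun j => ?_⟩
  beta_reduce
  generalize hinf.natEmbedding X j = y
  obtain ⟨x, ⟨s, hs⟩, hex, hax, hcx⟩ := y
  have hxx : x * x = x := by
    nth_rw 1 [hs]
    rw [mul_assoc, hax, ← hs]
  refine ⟨?_, hxx, ?_, ⟨x, hex.symm⟩, fun hmem => ?_⟩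
  · dsimp only
    rw [hs, hu]
    exact mul_mem_regularCore _ (mul_mem_regularCore _ he)
  · exact (leftIdeal_subset_iff.2 ⟨a, hax.symm⟩).antisymm (leftIdeal_subset_iff.2 ⟨s, hs⟩)
  · obtain ⟨i, y, hy⟩ := Set.mem_iUnion.1 hmem
    have hy' : x = c i * y := hy
    -- Idempotence moves the cofactor into `Sa`: `x = c i * y` gives `x = c i * (y * x)`.
    refine hcx i (y * x) ⟨y * s, ?_⟩ ?_
    · rw [mul_assoc, ← hs]
    · rw [← mul_assoc, ← hy', hxx]

/-- Two copies of the polygon `B` glued along the subpolygon `Q`. -/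
def Double {B : Type u} [MulAction S B] (Q : SubMulAction S B) : Type u :=
  {q : B × Bool // q.1 ∈ Q → q.2 = false}

namespace Double

variable {B : Type u} [MulAction S B] (Q : SubMulAction S B)

open Classical in
/-- The two inclusions of `B` in its double. -/
noncomputable def incl (i : Bool) (x : B) : Double Q :=
  ⟨(x, if x ∈ Q then false else i), fun h => if_pos h⟩

theorem incl_injective (i : Bool) : Function.Injective (incl Q i) := fun _ _ h =>
  congrArg (fun q : Double Q => q.1.1) h

theorem incl_snd (q : Double Q) : incl Q q.1.2 q.1.1 = q := by
  obtain ⟨⟨x, i⟩, h⟩ := q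
  refine Subtype.ext (Prod.ext rfl ?_)
  by_cases hx : x ∈ Q
  · exact (if_pos hx).trans (h hx).symm
  · exact if_neg hx

theorem incl_of_mem {x : B} (hx : x ∈ Q) (i : Bool) : incl Q i x = incl Q false x :=
  Subtype.ext (Prod.ext rfl ((if_pos hx).trans (if_pos hx).symm))

open Classical in
theorem mem_of_incl_eq {x y : B} (h : incl Q false x = incl Q true y) : x ∈ Q := by
  obtain rfl : x = y := congrArg (fun q : Double Q => q.1.1) h
  by_contra hx
  have h2 : (if x ∈ Q then false else false) = if x ∈ Q then false else true :=
    congrArg (fun q : Double Q => q.1.2) h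
  rw [if_neg hx, if_neg hx] at h2
  cases h2

theorem smul_incl_aux (s : S) (i : Bool) (x : B) :
    incl Q (incl Q i x).1.2 (s • x) = incl Q i (s • x) := by
  by_cases hx : x ∈ Q
  · rw [incl_of_mem Q (Q.smul_mem s hx), incl_of_mem Q (Q.smul_mem s hx) i]
  · congr
    exact if_neg hx

noncomputable instance : MulAction S (Double Q) where
  smul s q := incl Q q.1.2 (s • q.1.1)
  one_smul q := by
    change incl Q q.1.2 ((1 : S) • q.1.1) = q
    rw [one_smul, incl_snd]
  mul_smul s t q := by
    change incl Q q.1.2 ((s * t) • q.1.1) = incl Q (incl Q q.1.2 (t • q.1.1)).1.2 (s • t • q.1.1)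
    rw [smul_incl_aux, mul_smul]

/-- The two inclusions of `B` in its double, as homomorphisms. -/
noncomputable def inclHom (i : Bool) : B →[S] Double Q where
  toFun := incl Q i
  map_smul' s x := (smul_incl_aux Q s i x).symm

theorem isRegularPolygon (hB : IsRegularPolygon S B) : IsRegularPolygon S (Double Q) := by
  rw [isRegularPolygon_iff] at *
  intro q
  obtain ⟨e, he⟩ := hB q.1.1
  refine ⟨e, ?_⟩
  have := he.map (inclHom Q q.1.2) (incl_injective Q _)
  rwa [show inclHom Q q.1.2 q.1.1 = q from incl_snd Q q] at this

end Double

/-- Glue two copies of the core along `S(sa)`, and let `A` be the first copy together with `S(ta)`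
in the second. The second copy of `a` solves `s y = sa`, `t y = ta` with the latter value in the
second copy. A solution in the first copy would put `ta` in `S(sa)`; one in the second copy of
`S(ta)` would put `sa` in `S(ta)`. -/
theorem isRegularlyLinearlyOrdered_of_isModelCompleteClass
    (h : IsModelCompleteClass (regularPolygons S)) : IsRegularlyLinearlyOrdered S := by
  rintro a ha _ ⟨b, rfl, hba⟩ _ ⟨c, rfl, hca⟩ -
  obtain ⟨s, rfl⟩ := leftIdeal_subset_iff.1 hba
  obtain ⟨t, rfl⟩ := leftIdeal_subset_iff.1 hca
  by_contra hcon
  rw [not_or] at hcon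
  simp only [leftIdeal_subset_iff] at hcon
  obtain ⟨hst, hts⟩ := hcon
  let x₀ : core S := ⟨a, ha⟩
  let Q : SubMulAction S (core S) := cyclic (s • x₀)
  let i₀ := Double.inclHom Q false
  let i₁ := Double.inclHom Q true
  have hglue : i₁ (s • x₀) = i₀ (s • x₀) :=
    Double.incl_of_mem Q ⟨1, (one_smul _ _).symm⟩ true
  have htQ : t • x₀ ∉ Q := by
    rintro ⟨u, hu⟩
    exact hts ⟨u, congrArg Subtype.val hu⟩
  let A : SubMulAction S (Double Q) :=
    ⟨{y | (∃ x, y = i₀ x) ∨ ∃ u : S, y = i₁ (u • t • x₀)}, by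
      rintro v _ (⟨x, rfl⟩ | ⟨u, rfl⟩)
      · exact .inl ⟨v • x, (map_smul _ _ _).symm⟩
      · exact .inr ⟨v * u, by rw [← map_smul, mul_smul]⟩⟩
  obtain ⟨y, hyA, -, hy, -, -⟩ := exists_mem_of_isModelCompleteClass h
    (Double.isRegularPolygon Q isRegularPolygon_core) A ⟨i₀ x₀, .inl ⟨x₀, rfl⟩⟩ 1
    (ι := Bool) (κ := Empty) (fun i => cond i s t)
    (fun i => cond i (i₀ (s • x₀)) (i₁ (t • x₀)))
    (by
      rintro (_ | _)
      · exact .inr ⟨1, by rw [one_smul]; rfl⟩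
      · exact .inl ⟨_, rfl⟩)
    nofun ∅ Set.finite_empty (Set.empty_subset _)
    ⟨i₁ x₀, one_smul _ _, by
      rintro (_ | _)
      · exact (map_smul i₁ t x₀).symm
      · exact (map_smul i₁ s x₀).symm.trans hglue, nofun, id⟩
  have hs : s • y = i₀ (s • x₀) := hy true
  have ht : t • y = i₁ (t • x₀) := hy false
  rcases hyA with ⟨x, rfl⟩ | ⟨u, rfl⟩
  · rw [← map_smul] at ht
    have hx : t • x = t • x₀ := congrArg (fun q : Double Q => q.1.1) ht
    refine htQ ?_
    rw [← hx]
    exact Double.mem_of_incl_eq Q ht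
  · rw [← map_smul, ← hglue] at hs
    have hx := Double.incl_injective Q true hs
    refine hst ⟨s * u, ?_⟩
    rw [mul_assoc]
    exact (congrArg Subtype.val hx).symm

end Necessity

end SPolygon

open SPolygon
theorem theorem5p1 (S : Type u) [Monoid S] (hR : (regularCore S).Nonempty)
    (hax : IsAxiomatizable (regularPolygons S)) :
    IsModelCompleteClass (regularPolygons S) ↔
      (IsRegularlyLinearlyOrdered S ∧
        (∀ e ∈ regularCore S, IsIdempotentElem e →
          ∀ (a : S) (m : ℕ) (c : Fin m → S),
            leftIdeal a ⊂ leftIdeal e → e ∉ ⋃ i, rightIdeal (c i) →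
            ∃ f : ℕ → S, (∀ j k, j ≠ k → f j ≠ f k) ∧
              ∀ j, f j ∈ regularCore S ∧ IsIdempotentElem (f j) ∧
                leftIdeal a = leftIdeal (f j) ∧
                f j ∈ rightIdeal e \ ⋃ i, rightIdeal (c i)) ∧
        (∀ e ∈ regularCore S, ∀ f ∈ regularCore S,
          IsIdempotentElem e → IsIdempotentElem f → {x | ∃ s, x = e * s * f}.Infinite)) := by
  constructor
  · intro h
    exact ⟨isRegularlyLinearlyOrdered_of_isModelCompleteClass h,
      fun e he hee => approximations_of_isModelCompleteClass h he hee,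
      fun e he f hf hee _ => infinite_of_isModelCompleteClass h he hf hee⟩
  · rintro ⟨h1, h2, h3⟩
    exact isModelCompleteClass_of hR hax h1 (hasApproximations hax h2) h3
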